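/- Throughout, $\log$ is the natural logarithm and $|u|^{+}=\max\{0,u\}$. Let $\mathcal X$ be a countably infinite discrete alphabet, identified with $\mathbb N$. For a probability mass function $P$ on $\mathcal X$ let $H(P)=\sum_x P(x)\log\frac1{P(x)}\in[0,\infty]$ be its Shannon entropy, $P^{\downarrow}$ its decreasing rearrangement and, for $\alpha>1$, $\|P\|_\alpha=(\sum_x P(x)^\alpha)^{1/\alpha}$; $Q$ majorizes $P$ if $\sum_{i=1}^k P^{\downarrow}(i)\le\sum_{i=1}^k Q^{\downarrow}(i)$ for every $k\ge1$. For an $\mathcal X$-valued random variable $X$ with distribution $P_X$ write $H(X)=H(P_X)$. For a random variable $Y$ on the same probability space with values in a measurable space $\mathcal Y$, let $P_{X|Y}$ be the regular conditional distribution of $X$ given $Y$ and put $$H_1^{\mathrm A}(X|Y)=H_1^{\mathrm H}(X|Y)=H(X|Y)=\mathbb E[H(P_{X|Y})],$$ $$H_\alpha^{\mathrm A}(X|Y)=\frac{\alpha}{1-\alpha}\log\mathbb E[\|P_{X|Y}\|_\alpha],\qquad H_\alpha^{\mathrm H}(X|Y)=\frac{1}{1-\alpha}\log\mathbb E[\|P_{X|Y}\|_\alpha^\alpha]\qquad(1<\alpha<\infty)$$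 (the conditional Rényi entropies of Arimoto and of Hayashi). For an integer $L\ge1$ let $P_{\mathrm e}^{(L)}(X|Y)=\inf_f\mathbb P\{X\notin f(Y)\}$, the infimum being over all measurable maps $f$ that assign to each $y\in\mathcal Y$ a nonempty set of at most $L$ elements of $\mathcal X$. **Theorem.** Let $X$ be an $\mathcal X$-valued random variable with $H(X)<\infty$, let $(L_n)$ be a sequence of positive integers, and let $(X_n,Y_n)$ be a sequence of pairs of random variables, $X_n$ with values in $\mathcal X$ and $Y_n$ with values in a measurable space $\mathcal Y_n$. Let $1\le\alpha<\infty$, and suppose that at least one of the following conditions holds: (a) $\alpha>1$; (b) $(X_n)$ satisfies the asymptotic equipartition property, i.e. $\lim_{n\to\infty}\mathbb P\{\log\frac1{P_{X_n}(X_n)}\le(1-\delta)H(X_n)\}=0$ for every $\delta>0$, and $H(X_n)=O(1)$; (c) there is an $n_0$ such that $P_{X_n}$ majorizes $P_X$ for every $n\ge n_0$; (d) $X_n\to X$ in distribution and $H(X_n)\to H(X)$ as $n\to\infty$. Then, for each $\dagger\in\{\mathrm A,\mathrm H\}$, if $P_{\mathrm e}^{(L_n)}(X_n|Y_n)\to0$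 as $n\to\infty$, then $|H_\alpha^{\dagger}(X_n|Y_n)-\log L_n|^{+}\to0$ as $n\to\infty$. -/

import Mathlib

open MeasureTheory ProbabilityTheory Filter Topology
open scoped ENNReal NNReal

noncomputable section

namespace FanoList

/-- The probability mass function `P_X` of a random variable `X` with values in the countably
infinite alphabet `ℕ`. -/
def law {Ω : Type*} [MeasurableSpace Ω] (μ : Measure Ω) (X : Ω → ℕ) : ℕ → ℝ≥0∞ :=
  fun x => μ (X ⁻¹' {x})

/-- The conditional mass function `P_{X|Y}(· | Y = y)`, through the regular conditional
distribution of `X` given `Y`. -/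
def condLaw {Ω 𝓨 : Type*} [MeasurableSpace Ω] [MeasurableSpace 𝓨] (μ : Measure Ω)
    [IsProbabilityMeasure μ] (X : Ω → ℕ) (Y : Ω → 𝓨) (y : 𝓨) : ℕ → ℝ≥0∞ :=
  fun x => condDistrib X Y μ y {x}

/-- The decreasing rearrangement `p↓`, indexed from `0`: `p↓ i` is the least level `t` that is
exceeded by at most `i` of the values of `p`, i.e. the `(i+1)`-st largest value of `p`. -/
def decRearr (p : ℕ → ℝ≥0∞) (i : ℕ) : ℝ≥0∞ :=
  sInf {t : ℝ≥0∞ | {x : ℕ | t < p x}.encard ≤ (i : ℕ∞)}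

/-- `q` majorizes `p`: every partial sum of `p↓` is at most the corresponding one of `q↓`. -/
def Majorizes (q p : ℕ → ℝ≥0∞) : Prop :=
  ∀ k : ℕ, ∑ i ∈ Finset.range k, decRearr p i ≤ ∑ i ∈ Finset.range k, decRearr q i

/-- The Shannon entropy `∑ p(x) log (1 / p(x))` (natural logarithm, `0 log (1 / 0) = 0`) of a
probability mass function, with values in `[0, ∞]`. -/
def shannonEntropy (p : ℕ → ℝ≥0∞) : ℝ≥0∞ :=
  ∑' x, ENNReal.ofReal (Real.negMulLog (p x).toReal)

/-- The norm `‖p‖_α = (∑ p(x)^α)^(1/α)`. -/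
def alphaNorm (α : ℝ) (p : ℕ → ℝ≥0∞) : ℝ≥0∞ :=
  (∑' x, p x ^ α) ^ (1 / α)

section Conditional

variable {Ω 𝓨 : Type*} [MeasurableSpace Ω] [MeasurableSpace 𝓨]

/-- The conditional Shannon entropy `H(X|Y) = E[H(P_{X|Y})]`. -/
def condShannonEntropy (μ : Measure Ω) [IsProbabilityMeasure μ] (X : Ω → ℕ) (Y : Ω → 𝓨) :
    ℝ≥0∞ :=
  ∫⁻ ω, shannonEntropy (condLaw μ X Y (Y ω)) ∂μ

/-- Arimoto's conditional Rényi entropy `α / (1 - α) * log E[‖P_{X|Y}‖_α]`; for `α = 1` it is by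
convention the conditional Shannon entropy. -/
def arimotoEntropy (α : ℝ) (μ : Measure Ω) [IsProbabilityMeasure μ] (X : Ω → ℕ) (Y : Ω → 𝓨) :
    EReal :=
  if α = 1 then (condShannonEntropy μ X Y : EReal)
  else ((α / (1 - α) : ℝ) : EReal) *
    ENNReal.log (∫⁻ ω, alphaNorm α (condLaw μ X Y (Y ω)) ∂μ)

/-- Hayashi's conditional Rényi entropy `1 / (1 - α) * log E[‖P_{X|Y}‖_α ^ α]`; for `α = 1` it is
by convention the conditional Shannon entropy. -/
def hayashiEntropy (α : ℝ) (μ : Measure Ω) [IsProbabilityMeasure μ] (X : Ω → ℕ) (Y : Ω → 𝓨) :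
    EReal :=
  if α = 1 then (condShannonEntropy μ X Y : EReal)
  else ((1 / (1 - α) : ℝ) : EReal) *
    ENNReal.log (∫⁻ ω, alphaNorm α (condLaw μ X Y (Y ω)) ^ α ∂μ)

/-- A list decoder with list size `L`: a measurable map from `𝓨` to the nonempty sets of at most
`L` letters (the countable set of all finite sets of letters carries the discrete σ-algebra). -/
def IsListDecoder (L : ℕ) (f : 𝓨 → Finset ℕ) : Prop :=
  (∀ y, 1 ≤ (f y).card ∧ (f y).card ≤ L) ∧ ∀ D : Finset ℕ, MeasurableSet (f ⁻¹' {D})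

/-- The minimum average error probability `P_e^{(L)}(X|Y)` under list decoding with list
size `L`. -/
def listError (L : ℕ) (μ : Measure Ω) (X : Ω → ℕ) (Y : Ω → 𝓨) : ℝ≥0∞ :=
  ⨅ (f : 𝓨 → Finset ℕ) (_ : IsListDecoder L f), μ {ω | X ω ∉ f (Y ω)}

end Conditional

/-- The asymptotic equipartition property of a general source: for every `δ > 0`,
`P{log (1 / P_{X_n}(X_n)) ≤ (1 - δ) H(X_n)} → 0`. -/
def AEP {Ω : ℕ → Type*} [∀ n, MeasurableSpace (Ω n)] (μ : ∀ n, Measure (Ω n))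
    (X : ∀ n, Ω n → ℕ) : Prop :=
  ∀ δ : ℝ, 0 < δ →
    Tendsto (fun n => μ n {ω | ENNReal.log (law (μ n) (X n) (X n ω))⁻¹ ≤
      ((1 - δ : ℝ) : EReal) * (shannonEntropy (law (μ n) (X n)) : EReal)}) atTop (𝓝 0)

end FanoList

end

/-!
Fix a list decoder `f` with error event `E = {X ∉ f(Y)}`. For `α = 1`, Gibbs' inequality compares
`P_{X|Y=y}` with the subprobability weights `(1 - P(E)) / L` on the list `f(y)` and `P(E) P_X(x)` on
the other letters `x`. Averaging over `y` gives a Fano inequality for the infinite alphabet,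
`H(X|Y) ≤ log L + h(P(E)) + ∫_E log (1 / P_X(X))`, with `h` the binary entropy. The last term
vanishes with `P(E)` once the surprisals `log (1 / P_{X_n}(X_n))` are asymptotically uniformly
integrable, which each of the conditions (b), (c), (d) ensures. Under the equipartition property,
almost none of the bounded mean `H(X_n)` is left for a small event. Under majorization,
`∑ min(P_{X_n}(x), t) ≤ ∑ min(P_X(x), t)` for every `t`, and integrating over `t = e^{-u}` bounds
the surprisal tails by those of `X`. Under convergence in law and in entropy, the surprisals
truncated on finitely many letters already carry almost all of the entropy.

For `α > 1`, the power mean inequality on the list gives `P(Eᶜ) ≤ L^((α-1)/α) E‖P_{X|Y}‖_α`, that is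
`H_α^A(X|Y) ≤ log L + α / (α - 1) log (1 / P(Eᶜ))`. By Jensen's inequality `H_α^H ≤ H_α^A`.
-/

namespace FanoList

section Surprisal

/-- The surprisal `log (1 / q)` of an event of probability `q`, with values in `[0, ∞]`; it is
truncated to `0` for `q > 1`. -/
noncomputable def surprisal (q : ℝ≥0∞) : ℝ≥0∞ := (ENNReal.log q⁻¹).toENNReal

lemma surprisal_zero : surprisal 0 = ∞ := by simp [surprisal]

lemma surprisal_one : surprisal 1 = 0 := by simp [surprisal]

lemma surprisal_ofReal_exp_neg (σ : ℝ) :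
    surprisal (ENNReal.ofReal (Real.exp (-σ))) = ENNReal.ofReal σ := by
  rw [surprisal, ENNReal.log_inv, ENNReal.log_ofReal_of_pos (Real.exp_pos _), Real.log_exp,
    ← EReal.coe_neg, neg_neg, EReal.real_coe_toENNReal]

lemma exists_eq_ofReal_exp_neg {q : ℝ≥0∞} (h0 : q ≠ 0) (htop : q ≠ ∞) :
    ∃ σ : ℝ, q = ENNReal.ofReal (Real.exp (-σ)) :=
  ⟨-Real.log q.toReal, by
    rw [neg_neg, Real.exp_log (ENNReal.toReal_pos h0 htop), ENNReal.ofReal_toReal htop]⟩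

lemma coe_surprisal {q : ℝ≥0∞} (hq : q ≤ 1) : (surprisal q : EReal) = ENNReal.log q⁻¹ :=
  EReal.coe_toENNReal <| by simpa using ENNReal.log_le_log (ENNReal.one_le_inv.2 hq)

lemma continuous_surprisal : Continuous surprisal :=
  EReal.continuous_toENNReal.comp (ENNReal.continuous_log.comp continuous_inv)

lemma surprisal_mul_le (a b : ℝ≥0∞) : surprisal (a * b) ≤ surprisal a + surprisal b := by
  rcases eq_or_ne a 0 with rfl | ha
  · simp [surprisal_zero]
  rcases eq_or_ne b 0 with rfl | hb
  · simp [surprisal_zero]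
  rw [surprisal, ENNReal.mul_inv (.inl ha) (.inr hb), ENNReal.log_mul_add]
  exact EReal.toENNReal_add_le

lemma surprisal_natCast_inv (L : ℕ) :
    surprisal (L : ℝ≥0∞)⁻¹ = ENNReal.ofReal (Real.log L) := by
  rcases L.eq_zero_or_pos with rfl | hL
  · simp [surprisal]
  rw [surprisal, inv_inv, ← ENNReal.ofReal_natCast,
    ENNReal.log_ofReal_of_pos (by exact_mod_cast hL), EReal.real_coe_toENNReal]

lemma ofReal_negMulLog_toReal {q : ℝ≥0∞} (hq : q ≠ ∞) :
    ENNReal.ofReal (Real.negMulLog q.toReal) = q * surprisal q := by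
  rcases eq_or_ne q 0 with rfl | h0
  · simp
  obtain ⟨σ, rfl⟩ := exists_eq_ofReal_exp_neg h0 hq
  rw [surprisal_ofReal_exp_neg, ← ENNReal.ofReal_mul (Real.exp_pos _).le,
    ENNReal.toReal_ofReal (Real.exp_pos _).le, Real.negMulLog, Real.log_exp, neg_mul_neg]

lemma mul_surprisal_add_self_le {p : ℝ≥0∞} (hp : p ≤ 1) (q : ℝ≥0∞) :
    p * surprisal p + p ≤ p * surprisal q + q := by
  rcases eq_or_ne p 0 with rfl | hp0
  · simp
  rcases eq_or_ne q 0 with rfl | hq0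
  · simp [surprisal_zero, ENNReal.mul_top hp0]
  rcases eq_or_ne q ∞ with rfl | hqtop
  · simp
  obtain ⟨σ, rfl⟩ := exists_eq_ofReal_exp_neg hp0 (ne_top_of_le_ne_top ENNReal.one_ne_top hp)
  obtain ⟨τ, rfl⟩ := exists_eq_ofReal_exp_neg hq0 hqtop
  have hσ : 0 ≤ σ := by simpa using hp
  have hexp := Real.exp_pos (-σ)
  have key : Real.exp (-σ) * σ + Real.exp (-σ) ≤ Real.exp (-σ) * τ + Real.exp (-τ) := by
    have h := mul_le_mul_of_nonneg_left (Real.add_one_le_exp (σ - τ)) hexp.le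
    rw [← Real.exp_add, show -σ + (σ - τ) = -τ by ring] at h
    linarith
  rw [surprisal_ofReal_exp_neg, surprisal_ofReal_exp_neg, ← ENNReal.ofReal_mul hexp.le,
    ← ENNReal.ofReal_mul hexp.le, ← ENNReal.ofReal_add (by positivity) hexp.le]
  exact (ENNReal.ofReal_le_ofReal key).trans ENNReal.ofReal_add_le

lemma shannonEntropy_eq_tsum {p : ℕ → ℝ≥0∞} (hp : ∀ x, p x ≠ ∞) :
    shannonEntropy p = ∑' x, p x * surprisal (p x) :=
  tsum_congr fun x => ofReal_negMulLog_toReal (hp x)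

lemma shannonEntropy_le_tsum_mul_surprisal {p q : ℕ → ℝ≥0∞} (hp : ∑' x, p x = 1)
    (hq : ∑' x, q x ≤ 1) : shannonEntropy p ≤ ∑' x, p x * surprisal (q x) := by
  have hp1 : ∀ x, p x ≤ 1 := fun x => hp ▸ ENNReal.le_tsum x
  rw [shannonEntropy_eq_tsum fun x => ne_top_of_le_ne_top ENNReal.one_ne_top (hp1 x)]
  refine (ENNReal.add_le_add_iff_right ENNReal.one_ne_top).1 ?_
  calc ∑' x, p x * surprisal (p x) + 1
      = ∑' x, (p x * surprisal (p x) + p x) := by rw [ENNReal.tsum_add, hp]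
    _ ≤ ∑' x, (p x * surprisal (q x) + q x) :=
        ENNReal.tsum_le_tsum fun x => mul_surprisal_add_self_le (hp1 x) (q x)
    _ ≤ ∑' x, p x * surprisal (q x) + 1 := by rw [ENNReal.tsum_add]; gcongr

end Surprisal

section Law

variable {Ω 𝓨 : Type*} [MeasurableSpace Ω] [MeasurableSpace 𝓨]

lemma lintegral_comp_eq_tsum_law (μ : Measure Ω) {X : Ω → ℕ} (hX : Measurable X)
    (F : ℕ → ℝ≥0∞) : ∫⁻ ω, F (X ω) ∂μ = ∑' x, law μ X x * F x := by
  rw [← lintegral_map (measurable_from_top (f := F)) hX, lintegral_countable']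
  refine tsum_congr fun x => ?_
  rw [Measure.map_apply hX (measurableSet_singleton x), mul_comm, law]

variable (μ : Measure Ω) [IsProbabilityMeasure μ]

lemma tsum_law {X : Ω → ℕ} (hX : Measurable X) : ∑' x, law μ X x = 1 := by
  simpa using (lintegral_comp_eq_tsum_law μ hX (fun _ => 1)).symm

lemma law_le_one (X : Ω → ℕ) (x : ℕ) : law μ X x ≤ 1 := prob_le_one

lemma shannonEntropy_law {X : Ω → ℕ} (hX : Measurable X) :
    shannonEntropy (law μ X) = ∫⁻ ω, surprisal (law μ X (X ω)) ∂μ := by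
  rw [lintegral_comp_eq_tsum_law μ hX (fun x => surprisal (law μ X x))]
  exact shannonEntropy_eq_tsum fun _ => measure_ne_top _ _

lemma tsum_condLaw (X : Ω → ℕ) (Y : Ω → 𝓨) (y : 𝓨) : ∑' x, condLaw μ X Y y x = 1 := by
  have h := lintegral_countable' (μ := condDistrib X Y μ y) (fun _ => 1)
  simpa [condLaw] using h.symm

lemma measurable_condLaw (X : Ω → ℕ) (Y : Ω → 𝓨) (x : ℕ) :
    Measurable fun y => condLaw μ X Y y x :=
  Kernel.measurable_coe _ (measurableSet_singleton x)

lemma lintegral_tsum_condLaw {X : Ω → ℕ} (hX : Measurable X) {Y : Ω → 𝓨} (hY : Measurable Y)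
    {F : 𝓨 × ℕ → ℝ≥0∞} (hF : Measurable F) :
    ∫⁻ ω, ∑' x, condLaw μ X Y (Y ω) x * F (Y ω, x) ∂μ = ∫⁻ ω, F (Y ω, X ω) ∂μ := by
  rw [← lintegral_map hF (hY.prodMk hX), ← compProd_map_condDistrib hX.aemeasurable,
    Measure.lintegral_compProd hF, lintegral_map hF.lintegral_kernel_prod_right' hY]
  refine lintegral_congr fun ω => ?_
  rw [lintegral_countable']
  exact tsum_congr fun x => mul_comm _ _

end Law

section Fano

lemma mul_surprisal_add_mul_surprisal {a b : ℝ≥0∞} (hab : a + b = 1) :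
    a * surprisal a + b * surprisal b = ENNReal.ofReal (Real.binEntropy b.toReal) := by
  have ha : a ≤ 1 := hab ▸ le_self_add
  have hb : b ≤ 1 := hab ▸ le_add_self
  have ha' : a ≠ ∞ := ne_top_of_le_ne_top ENNReal.one_ne_top ha
  have hb' : b ≠ ∞ := ne_top_of_le_ne_top ENNReal.one_ne_top hb
  have hsum : 1 - b.toReal = a.toReal := by
    rw [sub_eq_iff_eq_add, ← ENNReal.toReal_add ha' hb', hab, ENNReal.toReal_one]
  rw [Real.binEntropy_eq_negMulLog_add_negMulLog_one_sub, hsum, ← ofReal_negMulLog_toReal ha',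
    ← ofReal_negMulLog_toReal hb', add_comm, ENNReal.ofReal_add]
  · exact Real.negMulLog_nonneg ENNReal.toReal_nonneg (ENNReal.toReal_mono ENNReal.one_ne_top hb)
  · exact Real.negMulLog_nonneg ENNReal.toReal_nonneg (ENNReal.toReal_mono ENNReal.one_ne_top ha)

lemma tsum_ite_mem_finset_le {D : Finset ℕ} {L : ℕ} (hD : D.card ≤ L) (a b : ℝ≥0∞)
    (q : ℕ → ℝ≥0∞) :
    ∑' x, (if x ∈ D then a * (L : ℝ≥0∞)⁻¹ else b * q x) ≤ a + b * ∑' x, q x :=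
  calc ∑' x, (if x ∈ D then a * (L : ℝ≥0∞)⁻¹ else b * q x)
      ≤ ∑' x, ((if x ∈ D then a * (L : ℝ≥0∞)⁻¹ else 0) + b * q x) :=
        ENNReal.tsum_le_tsum fun x => by split_ifs <;> simp
    _ = a * (D.card / L) + b * ∑' x, q x := by
        rw [ENNReal.tsum_add, ENNReal.tsum_mul_left, tsum_eq_sum (s := D) (by simp +contextual),
          Finset.sum_ite_mem, Finset.inter_self, Finset.sum_const, nsmul_eq_mul, mul_left_comm,
          div_eq_mul_inv]
    _ ≤ a * 1 + b * ∑' x, q x := by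
        gcongr
        exact (ENNReal.div_le_div_right (by exact_mod_cast hD) _).trans ENNReal.div_self_le_one
    _ = a + b * ∑' x, q x := by rw [mul_one]

lemma shannonEntropy_le_tsum_ite {p q : ℕ → ℝ≥0∞} (hp : ∑' x, p x = 1) (hq : ∑' x, q x ≤ 1)
    {D : Finset ℕ} {L : ℕ} (hD : D.card ≤ L) {a b : ℝ≥0∞} (hab : a + b ≤ 1) :
    shannonEntropy p ≤ ∑' x, p x *
      if x ∈ D then surprisal a + ENNReal.ofReal (Real.log L) else surprisal b + surprisal (q x) :=
  calc shannonEntropy p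
      ≤ ∑' x, p x * surprisal (if x ∈ D then a * (L : ℝ≥0∞)⁻¹ else b * q x) :=
        shannonEntropy_le_tsum_mul_surprisal hp <| (tsum_ite_mem_finset_le hD a b q).trans <|
          (add_le_add_right (mul_le_of_le_one_right' hq) a).trans hab
    _ ≤ _ := by
        gcongr with x
        split_ifs
        · exact surprisal_natCast_inv L ▸ surprisal_mul_le a _
        · exact surprisal_mul_le b _

variable {Ω 𝓨 : Type*} [MeasurableSpace Ω] [MeasurableSpace 𝓨] {L : ℕ} {f : 𝓨 → Finset ℕ}

lemma IsListDecoder.measurableSet_mem (hf : IsListDecoder L f) :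
    MeasurableSet {z : 𝓨 × ℕ | z.2 ∈ f z.1} := by
  have : {z : 𝓨 × ℕ | z.2 ∈ f z.1} = ⋃ D : Finset ℕ, (f ⁻¹' {D}) ×ˢ (D : Set ℕ) := by
    ext z
    simp
  rw [this]
  exact MeasurableSet.iUnion fun D => (hf.2 D).prod D.measurableSet

lemma IsListDecoder.measurableSet_error (hf : IsListDecoder L f) {X : Ω → ℕ} (hX : Measurable X)
    {Y : Ω → 𝓨} (hY : Measurable Y) : MeasurableSet {ω | X ω ∉ f (Y ω)} :=
  (hY.prodMk hX hf.measurableSet_mem).compl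

theorem condShannonEntropy_le (μ : Measure Ω) [IsProbabilityMeasure μ] {X : Ω → ℕ}
    (hX : Measurable X) {Y : Ω → 𝓨} (hY : Measurable Y) (hf : IsListDecoder L f) :
    condShannonEntropy μ X Y ≤ ENNReal.ofReal (Real.log L) +
      (ENNReal.ofReal (Real.binEntropy (μ.real {ω | X ω ∉ f (Y ω)})) +
        ∫⁻ ω in {ω | X ω ∉ f (Y ω)}, surprisal (law μ X (X ω)) ∂μ) := by
  have hE := hf.measurableSet_error hX hY
  set E := {ω | X ω ∉ f (Y ω)}
  have hE1 : μ Eᶜ + μ E = 1 := by rw [add_comm, prob_add_prob_compl hE]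
  let F : 𝓨 × ℕ → ℝ≥0∞ := fun z => if z.2 ∈ f z.1 then
    surprisal (μ Eᶜ) + ENNReal.ofReal (Real.log L) else surprisal (μ E) + surprisal (law μ X z.2)
  have hF : Measurable F := Measurable.ite hf.measurableSet_mem measurable_const <|
    (measurable_from_top (f := fun x : ℕ => surprisal (μ E) + surprisal (law μ X x))).comp
      measurable_snd
  calc condShannonEntropy μ X Y
      ≤ ∫⁻ ω, ∑' x, condLaw μ X Y (Y ω) x * F (Y ω, x) ∂μ :=
        lintegral_mono fun ω => shannonEntropy_le_tsum_ite (tsum_condLaw μ X Y (Y ω))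
          (tsum_law μ hX).le (hf.1 (Y ω)).2 hE1.le
    _ = ∫⁻ ω, F (Y ω, X ω) ∂μ := lintegral_tsum_condLaw μ hX hY hF
    _ = ∫⁻ ω in Eᶜ, F (Y ω, X ω) ∂μ + ∫⁻ ω in E, F (Y ω, X ω) ∂μ := by
        rw [add_comm, lintegral_add_compl _ hE]
    _ = ∫⁻ _ in Eᶜ, (surprisal (μ Eᶜ) + ENNReal.ofReal (Real.log L)) ∂μ +
          ∫⁻ ω in E, (surprisal (μ E) + surprisal (law μ X (X ω))) ∂μ := by
        congr 1
        · exact setLIntegral_congr_fun hE.compl fun ω hω => if_pos (not_not.1 hω)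
        · exact setLIntegral_congr_fun hE fun ω hω => if_neg hω
    _ = ENNReal.ofReal (Real.log L) * μ Eᶜ +
          ((μ Eᶜ * surprisal (μ Eᶜ) + μ E * surprisal (μ E)) +
            ∫⁻ ω in E, surprisal (law μ X (X ω)) ∂μ) := by
        rw [setLIntegral_const, lintegral_add_left measurable_const, setLIntegral_const]
        ring
    _ ≤ _ := by
        rw [mul_surprisal_add_mul_surprisal hE1]
        gcongr
        · exact mul_le_of_le_one_right' prob_le_one
        · rfl

end Fano

section Rearrangement

lemma lintegral_indicator_ofReal_lt (a : ℝ≥0∞) :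
    ∫⁻ s in Set.Ioi (0 : ℝ), {s | ENNReal.ofReal s < a}.indicator 1 s = a := by
  rw [lintegral_indicator_one (measurableSet_lt ENNReal.measurable_ofReal measurable_const),
    Measure.restrict_apply' measurableSet_Ioi]
  induction a with
  | top => simp
  | coe a =>
    have : {s : ℝ | ENNReal.ofReal s < a} ∩ Set.Ioi 0 = Set.Ioo 0 (a : ℝ) := by
      ext s
      refine (and_congr_left fun hs : 0 < s => ?_).trans and_comm
      exact ENNReal.ofReal_lt_coe_iff hs.le
    rw [this, Real.volume_Ioo, sub_zero, ENNReal.ofReal_coe_nnreal]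

lemma tsum_eq_lintegral_encard {ι : Type*} [Countable ι] (f : ι → ℝ≥0∞) :
    ∑' x, f x = ∫⁻ s in Set.Ioi (0 : ℝ), ({x | ENNReal.ofReal s < f x}.encard : ℝ≥0∞) := by
  have hmeas (x : ι) : MeasurableSet {s | ENNReal.ofReal s < f x} :=
    measurableSet_lt ENNReal.measurable_ofReal measurable_const
  calc ∑' x, f x
      = ∑' x, ∫⁻ s in Set.Ioi (0 : ℝ), {s | ENNReal.ofReal s < f x}.indicator 1 s := by
        simp only [lintegral_indicator_ofReal_lt]
    _ = ∫⁻ s in Set.Ioi (0 : ℝ), ∑' x, {s | ENNReal.ofReal s < f x}.indicator 1 s :=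
        (lintegral_tsum fun x => (measurable_one.indicator (hmeas x)).aemeasurable).symm
    _ = _ := lintegral_congr fun s => by
        rw [← ENNReal.tsum_set_one, tsum_subtype _ fun _ => 1]
        rfl

lemma tsum_eq_of_encard_setOf_lt_eq {ι κ : Type*} [Countable ι] [Countable κ] {f : ι → ℝ≥0∞}
    {g : κ → ℝ≥0∞} (h : ∀ t, {x | t < f x}.encard = {y | t < g y}.encard) :
    ∑' x, f x = ∑' y, g y := by
  simp only [tsum_eq_lintegral_encard, h]

lemma decRearr_le_iff {p : ℕ → ℝ≥0∞} {i : ℕ} {t : ℝ≥0∞} :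
    decRearr p i ≤ t ↔ {x | t < p x}.encard ≤ i := by
  refine ⟨fun h => ?_, fun h => sInf_le h⟩
  by_contra! hlt
  obtain ⟨A, hA, hcard⟩ := Set.exists_subset_encard_eq (Order.add_one_le_of_lt hlt)
  have hfin : A.Finite := Set.finite_of_encard_eq_coe (k := i + 1) (by exact_mod_cast hcard)
  have hne : A.Nonempty := by
    rw [← Set.encard_ne_zero, hcard]
    simp
  obtain ⟨m, hmA, hm⟩ := Set.exists_min_image A p hfin hne
  have hle : p m ≤ decRearr p i := le_sInf fun s hs => by
    by_contra! hsm
    have hsub : A ⊆ {x | s < p x} := fun x hx => hsm.trans_le (hm x hx)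
    have := (hcard.symm.le.trans (Set.encard_le_encard hsub)).trans hs
    exact absurd this (by norm_cast; omega)
  exact ((hA hmA).trans_le hle).not_ge h

lemma antitone_decRearr (p : ℕ → ℝ≥0∞) : Antitone (decRearr p) := fun _ _ hij =>
  decRearr_le_iff.2 <| (decRearr_le_iff.1 le_rfl).trans (by exact_mod_cast hij)

lemma encard_setOf_natCast_lt (N : ℕ∞) : {i : ℕ | (i : ℕ∞) < N}.encard = N := by
  induction N with
  | top => simp
  | coe n => simpa [Set.Iio_def] using Set.encard_coe_eq_coe_finsetCard (Finset.range n)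

lemma encard_setOf_lt_decRearr (p : ℕ → ℝ≥0∞) (t : ℝ≥0∞) :
    {i | t < decRearr p i}.encard = {x | t < p x}.encard := by
  simpa only [← not_le, decRearr_le_iff] using encard_setOf_natCast_lt {x | t < p x}.encard

lemma tsum_decRearr_tsub (p : ℕ → ℝ≥0∞) (t : ℝ≥0∞) :
    ∑' i, (decRearr p i - t) = ∑' x, (p x - t) :=
  tsum_eq_of_encard_setOf_lt_eq fun s => by
    simpa only [lt_tsub_iff_right] using encard_setOf_lt_decRearr p (s + t)

lemma Majorizes.tsum_tsub_le {q p : ℕ → ℝ≥0∞} (h : Majorizes q p) (t : ℝ≥0∞) :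
    ∑' x, (p x - t) ≤ ∑' x, (q x - t) := by
  rcases eq_or_ne t ∞ with rfl | ht
  · simp
  rw [← tsum_decRearr_tsub p, ← tsum_decRearr_tsub q]
  refine ENNReal.tsum_le_of_sum_range_le fun n => ?_
  induction n with
  | zero => simp
  | succ n ih =>
    rcases le_or_gt (decRearr p n) t with hn | hn
    · rwa [Finset.sum_range_succ, tsub_eq_zero_of_le hn, add_zero]
    have hle (i) (hi : i ∈ Finset.range (n + 1)) : t ≤ decRearr p i :=
      hn.le.trans (antitone_decRearr p (Finset.mem_range_succ_iff.1 hi))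
    have htop : ∑ _i ∈ Finset.range (n + 1), t ≠ ∞ := ENNReal.sum_ne_top.2 fun _ _ => ht
    refine (ENNReal.add_le_add_iff_right htop).1 ?_
    calc ∑ i ∈ Finset.range (n + 1), (decRearr p i - t) + ∑ _i ∈ Finset.range (n + 1), t
        = ∑ i ∈ Finset.range (n + 1), decRearr p i := by
          rw [← Finset.sum_add_distrib]
          exact Finset.sum_congr rfl fun i hi => tsub_add_cancel_of_le (hle i hi)
      _ ≤ ∑ i ∈ Finset.range (n + 1), decRearr q i := h (n + 1)
      _ ≤ ∑ i ∈ Finset.range (n + 1), (decRearr q i - t) + ∑ _i ∈ Finset.range (n + 1), t := by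
          rw [← Finset.sum_add_distrib]
          exact Finset.sum_le_sum fun i _ => le_tsub_add
      _ ≤ ∑' i, (decRearr q i - t) + ∑ _i ∈ Finset.range (n + 1), t := by
          gcongr
          exact ENNReal.sum_le_tsum _

lemma Majorizes.tsum_min_le {q p : ℕ → ℝ≥0∞} (h : Majorizes q p) (hqp : ∑' x, q x ≤ ∑' x, p x)
    (hq : ∑' x, q x ≠ ∞) (t : ℝ≥0∞) : ∑' x, min (q x) t ≤ ∑' x, min (p x) t := by
  have split (r : ℕ → ℝ≥0∞) : ∑' x, (r x - t) + ∑' x, min (r x) t = ∑' x, r x := by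
    simp only [← ENNReal.tsum_add, tsub_add_min]
  have hfin : ∑' x, (q x - t) ≠ ∞ :=
    ne_top_of_le_ne_top hq (ENNReal.tsum_le_tsum fun _ => tsub_le_self)
  refine (ENNReal.add_le_add_iff_left hfin).1 ?_
  calc ∑' x, (q x - t) + ∑' x, min (q x) t
      = ∑' x, q x := split q
    _ ≤ ∑' x, (p x - t) + ∑' x, min (p x) t := hqp.trans (split p).ge
    _ ≤ ∑' x, (q x - t) + ∑' x, min (p x) t := add_le_add_left (h.tsum_tsub_le t) _

end Rearrangement

section EntropyTail

/-- The contribution `∫_K^∞ min(q, e^{-u}) du` of the surprisals above `K` to an entropy, for an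
atom of mass `q`. It differs from `q (log (1 / q) - K)⁺` by at most `q`, but is an integral of the
truncations `min q t`, which majorization compares. -/
noncomputable def entropyTail (K : ℝ) (q : ℝ≥0∞) : ℝ≥0∞ :=
  ∫⁻ u in Set.Ioi K, min q (ENNReal.ofReal (Real.exp (-u)))

lemma lintegral_Ioi_ofReal_exp_neg (c : ℝ) :
    ∫⁻ u in Set.Ioi c, ENNReal.ofReal (Real.exp (-u)) = ENNReal.ofReal (Real.exp (-c)) := by
  rw [← ofReal_integral_eq_lintegral_ofReal (integrableOn_exp_neg_Ioi c)
    (ae_of_all _ fun u => (Real.exp_pos _).le), integral_exp_neg_Ioi]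

lemma mul_surprisal_tsub_le_entropyTail (K : ℝ≥0) (q : ℝ≥0∞) :
    q * (surprisal q - K) ≤ entropyTail K q := by
  rcases eq_or_ne q 0 with rfl | h0
  · simp
  rcases eq_or_ne q ∞ with rfl | htop
  · simp [surprisal]
  obtain ⟨σ, rfl⟩ := exists_eq_ofReal_exp_neg h0 htop
  calc _ = ∫⁻ _ in Set.Ioc (K : ℝ) σ, ENNReal.ofReal (Real.exp (-σ)) := by
        rw [setLIntegral_const, Real.volume_Ioc, surprisal_ofReal_exp_neg,
          ENNReal.ofReal_sub _ K.coe_nonneg, ENNReal.ofReal_coe_nnreal]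
    _ ≤ ∫⁻ u in Set.Ioc (K : ℝ) σ,
          min (ENNReal.ofReal (Real.exp (-σ))) (ENNReal.ofReal (Real.exp (-u))) :=
        setLIntegral_mono' measurableSet_Ioc fun u hu => le_min le_rfl <|
          ENNReal.ofReal_le_ofReal (Real.exp_le_exp.2 (neg_le_neg hu.2))
    _ ≤ entropyTail K (ENNReal.ofReal (Real.exp (-σ))) :=
        lintegral_mono_set Set.Ioc_subset_Ioi_self

lemma entropyTail_zero_le (q : ℝ≥0∞) : entropyTail 0 q ≤ q * surprisal q + q := by
  rcases eq_or_ne q 0 with rfl | h0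
  · simp [entropyTail]
  rcases eq_or_ne q ∞ with rfl | htop
  · simp
  obtain ⟨σ, rfl⟩ := exists_eq_ofReal_exp_neg h0 htop
  calc entropyTail 0 (ENNReal.ofReal (Real.exp (-σ)))
      ≤ ∫⁻ u in Set.Ioc 0 σ ∪ Set.Ioi σ,
          min (ENNReal.ofReal (Real.exp (-σ))) (ENNReal.ofReal (Real.exp (-u))) :=
        lintegral_mono_set fun u hu => (le_or_gt u σ).imp (fun h => ⟨hu, h⟩) id
    _ ≤ (∫⁻ _ in Set.Ioc 0 σ, ENNReal.ofReal (Real.exp (-σ))) +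
          ∫⁻ u in Set.Ioi σ, ENNReal.ofReal (Real.exp (-u)) :=
        (lintegral_union_le _ _ _).trans <|
          add_le_add (lintegral_mono fun u => min_le_left _ _)
            (lintegral_mono fun u => min_le_right _ _)
    _ = _ := by
        rw [setLIntegral_const, Real.volume_Ioc, sub_zero, lintegral_Ioi_ofReal_exp_neg,
          surprisal_ofReal_exp_neg]

lemma tsum_entropyTail (p : ℕ → ℝ≥0∞) (K : ℝ) :
    ∑' x, entropyTail K (p x) =
      ∫⁻ u in Set.Ioi K, ∑' x, min (p x) (ENNReal.ofReal (Real.exp (-u))) :=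
  (lintegral_tsum fun x => by fun_prop).symm

lemma Majorizes.tsum_entropyTail_le {q p : ℕ → ℝ≥0∞} (h : Majorizes q p)
    (hqp : ∑' x, q x ≤ ∑' x, p x) (hq : ∑' x, q x ≠ ∞) (K : ℝ) :
    ∑' x, entropyTail K (q x) ≤ ∑' x, entropyTail K (p x) := by
  simp only [tsum_entropyTail]
  exact lintegral_mono fun u => h.tsum_min_le hqp hq _

lemma tendsto_setLIntegral_Ioi_atTop {g : ℝ → ℝ≥0∞} {a : ℝ} (hg : ∫⁻ u in Set.Ioi a, g u ≠ ∞) :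
    Tendsto (fun K => ∫⁻ u in Set.Ioi K, g u) atTop (𝓝 0) := by
  have h := tendsto_measure_iInter_atTop (μ := volume.withDensity g) (s := Set.Ioi)
    (fun K => measurableSet_Ioi.nullMeasurableSet) antitone_Ioi
    ⟨a, by rwa [withDensity_apply _ measurableSet_Ioi]⟩
  have hempty : ⋂ K : ℝ, Set.Ioi K = ∅ :=
    Set.eq_empty_of_forall_notMem fun u hu => lt_irrefl u (Set.mem_iInter.1 hu u)
  rw [hempty, measure_empty] at h
  exact h.congr fun K => withDensity_apply _ measurableSet_Ioi

lemma tendsto_tsum_entropyTail {p : ℕ → ℝ≥0∞} (hp : ∑' x, p x ≠ ∞) (hH : shannonEntropy p ≠ ∞) :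
    Tendsto (fun K => ∑' x, entropyTail K (p x)) atTop (𝓝 0) := by
  have hfin : ∑' x, entropyTail 0 (p x) ≠ ∞ := by
    refine ne_top_of_le_ne_top (ENNReal.add_ne_top.2 ⟨hH, hp⟩) ?_
    rw [shannonEntropy_eq_tsum (ENNReal.ne_top_of_tsum_ne_top hp), ← ENNReal.tsum_add]
    exact ENNReal.tsum_le_tsum fun x => entropyTail_zero_le (p x)
  simp only [tsum_entropyTail] at hfin ⊢
  exact tendsto_setLIntegral_Ioi_atTop hfin

end EntropyTail

section UniformIntegrability

variable {ι : Type*} {l : Filter ι} {Ω : ι → Type*} [∀ n, MeasurableSpace (Ω n)]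
  {μ : ∀ n, Measure (Ω n)}

/-- Asymptotic uniform integrability of nonnegative functions `f n` on possibly different measure
spaces, in the form in which Fano's inequality needs it: integrals over events of vanishing measure
vanish. -/
def AsympUnifIntegrable (μ : ∀ n, Measure (Ω n)) (f : ∀ n, Ω n → ℝ≥0∞) (l : Filter ι) : Prop :=
  ∀ E : ∀ n, Set (Ω n), (∀ n, MeasurableSet (E n)) → Tendsto (fun n => μ n (E n)) l (𝓝 0) →
    Tendsto (fun n => ∫⁻ ω in E n, f n ω ∂μ n) l (𝓝 0)

lemma asympUnifIntegrable_of_lintegral_tsub_le {f : ∀ n, Ω n → ℝ≥0∞}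
    (h : ∀ η : ℝ≥0∞, 0 < η → ∃ K : ℝ≥0, ∀ᶠ n in l, ∫⁻ ω, (f n ω - K) ∂μ n ≤ η) :
    AsympUnifIntegrable μ f l := by
  intro E _ hE
  refine ENNReal.tendsto_nhds_zero.2 fun η hη => ?_
  obtain ⟨K, hK⟩ := h (η / 2) (ENNReal.half_pos hη.ne')
  have hKE : Tendsto (fun n => (K : ℝ≥0∞) * μ n (E n)) l (𝓝 0) := by
    simpa using ENNReal.Tendsto.const_mul hE (.inr ENNReal.coe_ne_top)
  filter_upwards [hK, ENNReal.tendsto_nhds_zero.1 hKE _ (ENNReal.half_pos hη.ne')] with n h1 h2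
  calc ∫⁻ ω in E n, f n ω ∂μ n
      ≤ ∫⁻ ω in E n, ((f n ω - K) + K) ∂μ n := lintegral_mono fun ω => le_tsub_add
    _ = ∫⁻ ω in E n, (f n ω - K) ∂μ n + K * μ n (E n) := by
        rw [lintegral_add_right _ measurable_const, setLIntegral_const]
    _ ≤ η / 2 + η / 2 := add_le_add ((setLIntegral_le_lintegral _ _).trans h1) h2
    _ = η := ENNReal.add_halves η

lemma setLIntegral_le_of_concentration {Ω : Type*} [MeasurableSpace Ω] {μ : Measure Ω}
    [IsProbabilityMeasure μ] {f : Ω → ℝ≥0∞} (hf : Measurable f) (hfin : ∫⁻ ω, f ω ∂μ ≠ ∞)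
    {E : Set Ω} (hE : MeasurableSet E) {a : ℝ≥0∞} (ha : a ≤ 1) :
    ∫⁻ ω in E, f ω ∂μ ≤
      (∫⁻ ω, f ω ∂μ) * (1 - a + (μ E + μ {ω | f ω ≤ a * ∫⁻ ω, f ω ∂μ})) := by
  set H := ∫⁻ ω, f ω ∂μ
  set B := {ω | f ω ≤ a * H}
  have hB : MeasurableSet B := hf measurableSet_Iic
  have hcompl : ∫⁻ ω in Eᶜ, f ω ∂μ ≠ ∞ :=
    ne_top_of_le_ne_top hfin (setLIntegral_le_lintegral _ _)
  have hcover : 1 ≤ μ (Eᶜ ∩ Bᶜ) + (μ E + μ B) := by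
    rw [← Set.compl_union, ← prob_add_prob_compl (μ := μ) (hE.union hB), add_comm]
    gcongr
    exact measure_union_le E B
  have hlarge : a * H * μ (Eᶜ ∩ Bᶜ) ≤ ∫⁻ ω in Eᶜ, f ω ∂μ := by
    rw [← setLIntegral_const]
    exact (setLIntegral_mono' (hE.compl.inter hB.compl) fun ω hω =>
      (lt_of_not_ge fun hle => hω.2 hle).le).trans
      (lintegral_mono_set Set.inter_subset_left)
  refine (ENNReal.add_le_add_iff_right hcompl).1 ?_
  calc ∫⁻ ω in E, f ω ∂μ + ∫⁻ ω in Eᶜ, f ω ∂μ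
      = H * (1 - a) + a * H * 1 := by
        rw [lintegral_add_compl _ hE, mul_one, mul_comm a, ← mul_add, tsub_add_cancel_of_le ha,
          mul_one]
    _ ≤ H * (1 - a) + (a * H * μ (Eᶜ ∩ Bᶜ) + a * H * (μ E + μ B)) := by
        rw [← mul_add (a * H)]
        gcongr
    _ ≤ H * (1 - a) + (∫⁻ ω in Eᶜ, f ω ∂μ + 1 * H * (μ E + μ B)) := by gcongr
    _ = H * (1 - a + (μ E + μ B)) + ∫⁻ ω in Eᶜ, f ω ∂μ := by ring

lemma asympUnifIntegrable_of_concentration [∀ n, IsProbabilityMeasure (μ n)]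
    {f : ∀ n, Ω n → ℝ≥0∞} (hf : ∀ n, Measurable (f n)) {C : ℝ≥0}
    (hC : ∀ᶠ n in l, ∫⁻ ω, f n ω ∂μ n ≤ C)
    (h : ∀ a : ℝ≥0, a < 1 →
      Tendsto (fun n => μ n {ω | f n ω ≤ a * ∫⁻ ω, f n ω ∂μ n}) l (𝓝 0)) :
    AsympUnifIntegrable μ f l := by
  intro E hEmeas hE
  refine ENNReal.tendsto_nhds_zero.2 fun η hη => ?_
  obtain ⟨d, hd, hdη⟩ := ENNReal.exists_nnreal_pos_mul_lt
    (ENNReal.mul_ne_top ENNReal.coe_ne_top ENNReal.ofNat_ne_top : (C : ℝ≥0∞) * 3 ≠ ∞) hη.ne'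
  have ha : 1 - d < 1 := tsub_lt_self one_pos hd
  have hd' : (0 : ℝ≥0∞) < d := by exact_mod_cast hd
  filter_upwards [hC, ENNReal.tendsto_nhds_zero.1 hE d hd',
    ENNReal.tendsto_nhds_zero.1 (h _ ha) d hd'] with n hCn hEn hBn
  calc ∫⁻ ω in E n, f n ω ∂μ n
      ≤ _ := setLIntegral_le_of_concentration (hf n)
        (ne_top_of_le_ne_top ENNReal.coe_ne_top hCn) (hEmeas n) (ENNReal.coe_le_one_iff.2 ha.le)
    _ ≤ C * (d + (d + d)) := by
        gcongr
        exact_mod_cast tsub_tsub_le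
    _ = d * (C * 3) := by ring
    _ ≤ η := hdη.le

end UniformIntegrability

section SurprisalUniformIntegrability

variable {ι : Type*} {l : Filter ι}

lemma exists_shannonEntropy_lt_sum_mul_min {p : ℕ → ℝ≥0∞} (hp : ∀ x, p x ≠ ∞)
    (hH : shannonEntropy p ≠ ∞) {η : ℝ≥0∞} (hη : 0 < η) :
    ∃ (S : Finset ℕ) (K : ℕ), shannonEntropy p < ∑ x ∈ S, p x * min (surprisal (p x)) K + η := by
  have hlt : shannonEntropy p < shannonEntropy p + η := ENNReal.lt_add_right hH hη.ne'
  have hS : Tendsto (fun S : Finset ℕ => ∑ x ∈ S, p x * surprisal (p x) + η) atTop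
      (𝓝 (shannonEntropy p + η)) := by
    rw [shannonEntropy_eq_tsum hp]
    exact Tendsto.add ENNReal.summable.hasSum tendsto_const_nhds
  obtain ⟨S, hS⟩ := (hS.eventually_const_lt hlt).exists
  have hK : Tendsto (fun K : ℕ => ∑ x ∈ S, p x * min (surprisal (p x)) K + η) atTop
      (𝓝 (∑ x ∈ S, p x * surprisal (p x) + η)) := by
    refine (tendsto_finsetSum S fun x _ => ?_).add tendsto_const_nhds
    refine ENNReal.Tendsto.const_mul ?_ (.inr (hp x))
    simpa using tendsto_const_nhds.min ENNReal.tendsto_nat_nhds_top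
  exact ⟨S, (hK.eventually_const_lt hS).exists⟩

lemma exists_eventually_tsum_mul_surprisal_tsub_le {q : ι → ℕ → ℝ≥0∞} {p : ℕ → ℝ≥0∞}
    (hq : ∀ n x, q n x ≠ ∞) (hp : ∀ x, p x ≠ ∞) (hH : shannonEntropy p ≠ ∞)
    (hlim : ∀ x, Tendsto (fun n => q n x) l (𝓝 (p x)))
    (hent : Tendsto (fun n => shannonEntropy (q n)) l (𝓝 (shannonEntropy p)))
    {η : ℝ≥0∞} (hη : 0 < η) :
    ∃ K : ℝ≥0, ∀ᶠ n in l, ∑' x, q n x * (surprisal (q n x) - K) ≤ η := by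
  obtain ⟨S, K, hSK⟩ := exists_shannonEntropy_lt_sum_mul_min hp hH hη
  have hmin (a : ℝ≥0∞) : min (surprisal a) K ≠ ∞ :=
    ne_top_of_le_ne_top (ENNReal.natCast_ne_top K) (min_le_right _ _)
  have hbody : Tendsto (fun n => ∑ x ∈ S, q n x * min (surprisal (q n x)) K) l
      (𝓝 (∑ x ∈ S, p x * min (surprisal (p x)) K)) :=
    tendsto_finsetSum S fun x _ => ENNReal.Tendsto.mul (hlim x) (.inr (hmin _))
      (((continuous_surprisal.tendsto _).comp (hlim x)).min tendsto_const_nhds) (.inr (hp x))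
  refine ⟨K, ?_⟩
  filter_upwards [hent.eventually_lt (hbody.add tendsto_const_nhds) hSK] with n hn
  have hfin : ∑ x ∈ S, q n x * min (surprisal (q n x)) K ≠ ∞ :=
    ENNReal.sum_ne_top.2 fun x _ => ENNReal.mul_ne_top (hq n x) (hmin _)
  refine (ENNReal.add_le_add_iff_left hfin).1 ?_
  calc ∑ x ∈ S, q n x * min (surprisal (q n x)) K + ∑' x, q n x * (surprisal (q n x) - K)
      ≤ ∑' x, q n x * min (surprisal (q n x)) K + ∑' x, q n x * (surprisal (q n x) - K) := by
        gcongr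
        exact ENNReal.sum_le_tsum S
    _ = shannonEntropy (q n) := by
        simp only [shannonEntropy_eq_tsum (hq n), ← ENNReal.tsum_add, ← mul_add,
          add_comm (min _ _), tsub_add_min]
    _ ≤ _ := hn.le

variable {Ω : ι → Type*} [∀ n, MeasurableSpace (Ω n)] {μ : ∀ n, Measure (Ω n)}
  {X : ∀ n, Ω n → ℕ}

lemma asympUnifIntegrable_surprisal_of_tsum_le (hX : ∀ n, Measurable (X n))
    (h : ∀ η : ℝ≥0∞, 0 < η → ∃ K : ℝ≥0, ∀ᶠ n in l,
      ∑' x, law (μ n) (X n) x * (surprisal (law (μ n) (X n) x) - K) ≤ η) :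
    AsympUnifIntegrable μ (fun n ω => surprisal (law (μ n) (X n) (X n ω))) l := by
  refine asympUnifIntegrable_of_lintegral_tsub_le fun η hη => (h η hη).imp fun K hK => ?_
  filter_upwards [hK] with n hn
  rwa [lintegral_comp_eq_tsum_law (μ n) (hX n) fun x => surprisal (law (μ n) (X n) x) - K]

variable [∀ n, IsProbabilityMeasure (μ n)]

lemma asympUnifIntegrable_surprisal_of_majorizes (hX : ∀ n, Measurable (X n)) {p : ℕ → ℝ≥0∞}
    (hp : ∑' x, p x = 1) (hH : shannonEntropy p ≠ ∞)
    (h : ∀ᶠ n in l, Majorizes (law (μ n) (X n)) p) :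
    AsympUnifIntegrable μ (fun n ω => surprisal (law (μ n) (X n) (X n ω))) l := by
  refine asympUnifIntegrable_surprisal_of_tsum_le hX fun η hη => ?_
  have htail := tendsto_tsum_entropyTail (hp ▸ ENNReal.one_ne_top) hH
  obtain ⟨K, hK, hK0⟩ :=
    ((ENNReal.tendsto_nhds_zero.1 htail η hη).and (eventually_ge_atTop 0)).exists
  lift K to ℝ≥0 using hK0
  refine ⟨K, ?_⟩
  filter_upwards [h] with n hn
  have hlaw := tsum_law (μ n) (hX n)
  calc ∑' x, law (μ n) (X n) x * (surprisal (law (μ n) (X n) x) - K)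
      ≤ ∑' x, entropyTail K (law (μ n) (X n) x) :=
        ENNReal.tsum_le_tsum fun x => mul_surprisal_tsub_le_entropyTail K _
    _ ≤ ∑' x, entropyTail K (p x) :=
        hn.tsum_entropyTail_le (hlaw.trans hp.symm).le (hlaw ▸ ENNReal.one_ne_top) K
    _ ≤ η := hK

lemma asympUnifIntegrable_surprisal_of_tendsto_law (hX : ∀ n, Measurable (X n)) {p : ℕ → ℝ≥0∞}
    (hp : ∀ x, p x ≠ ∞) (hH : shannonEntropy p ≠ ∞)
    (hlaw : ∀ x, Tendsto (fun n => law (μ n) (X n) x) l (𝓝 (p x)))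
    (hent : Tendsto (fun n => shannonEntropy (law (μ n) (X n))) l (𝓝 (shannonEntropy p))) :
    AsympUnifIntegrable μ (fun n ω => surprisal (law (μ n) (X n) (X n ω))) l :=
  asympUnifIntegrable_surprisal_of_tsum_le hX fun _ hη =>
    exists_eventually_tsum_mul_surprisal_tsub_le (fun _ _ => measure_ne_top _ _) hp hH hlaw hent hη

lemma tendsto_law_of_tendstoInDistribution {Ω' : Type*} [MeasurableSpace Ω'] {ν : Measure Ω'}
    [IsProbabilityMeasure ν] {Z : Ω' → ℕ} (hX : ∀ n, Measurable (X n)) (hZ : Measurable Z)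
    (h : TendstoInDistribution X l Z μ ν) (x : ℕ) :
    Tendsto (fun n => law (μ n) (X n) x) l (𝓝 (law ν Z x)) := by
  simpa [Measure.map_apply (hX _) (measurableSet_singleton x),
    Measure.map_apply hZ (measurableSet_singleton x), law] using
    ProbabilityMeasure.tendsto_measure_of_null_frontier_of_tendsto' h.tendsto (E := {x}) (by simp)

end SurprisalUniformIntegrability

lemma asympUnifIntegrable_surprisal_of_aep {Ω : ℕ → Type*} [∀ n, MeasurableSpace (Ω n)]
    {μ : ∀ n, Measure (Ω n)} [∀ n, IsProbabilityMeasure (μ n)] {X : ∀ n, Ω n → ℕ}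
    (hX : ∀ n, Measurable (X n)) (haep : AEP μ X) {C : ℝ≥0}
    (hC : ∀ᶠ n in atTop, shannonEntropy (law (μ n) (X n)) ≤ C) :
    AsympUnifIntegrable μ (fun n ω => surprisal (law (μ n) (X n) (X n ω))) atTop := by
  refine asympUnifIntegrable_of_concentration
    (fun n => (measurable_from_top (f := fun x : ℕ => surprisal (law (μ n) (X n) x))).comp (hX n))
    (hC.mono fun n hn => (shannonEntropy_law (μ n) (hX n)).ge.trans hn) fun a ha => ?_
  refine (haep (1 - a) (sub_pos.2 (by exact_mod_cast ha))).congr fun n => ?_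
  congr! 3 with ω
  rw [← coe_surprisal (law_le_one _ _ _), sub_sub_cancel, shannonEntropy_law (μ n) (hX n),
    ← EReal.coe_ennreal_le_coe_ennreal_iff, EReal.coe_ennreal_mul]
  rfl

section Renyi

lemma sum_le_rpow_mul_alphaNorm {α : ℝ} (hα : 1 ≤ α) (p : ℕ → ℝ≥0∞) (D : Finset ℕ) :
    ∑ x ∈ D, p x ≤ (D.card : ℝ≥0∞) ^ ((α - 1) / α) * alphaNorm α p := by
  have hα0 : 0 < α := one_pos.trans_le hα
  calc ∑ x ∈ D, p x
      = ((∑ x ∈ D, p x) ^ α) ^ (1 / α) := by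
        rw [← ENNReal.rpow_mul, mul_one_div_cancel hα0.ne', ENNReal.rpow_one]
    _ ≤ ((D.card : ℝ≥0∞) ^ (α - 1) * ∑' x, p x ^ α) ^ (1 / α) := by
        gcongr
        exact (ENNReal.rpow_sum_le_const_mul_sum_rpow D p hα).trans <| by
          gcongr
          exact ENNReal.sum_le_tsum D
    _ = (D.card : ℝ≥0∞) ^ ((α - 1) / α) * alphaNorm α p := by
        rw [ENNReal.mul_rpow_of_nonneg _ _ (by positivity), ← ENNReal.rpow_mul, mul_one_div,
          alphaNorm]

lemma lintegral_rpow_le_lintegral_rpow {Ω : Type*} [MeasurableSpace Ω] (μ : Measure Ω)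
    [IsProbabilityMeasure μ] {α : ℝ} (hα : 1 ≤ α) {g : Ω → ℝ≥0∞} (hg : Measurable g) :
    (∫⁻ ω, g ω ∂μ) ^ α ≤ ∫⁻ ω, g ω ^ α ∂μ := by
  have h := eLpNorm'_le_eLpNorm'_of_exponent_le one_pos hα μ hg.aestronglyMeasurable
  have hα0 : 0 < α := one_pos.trans_le hα
  simp only [eLpNorm', enorm_eq_self, ENNReal.rpow_one, div_one] at h
  simpa [← ENNReal.rpow_mul, hα0.ne'] using ENNReal.rpow_le_rpow h hα0.le

variable {Ω 𝓨 : Type*} [MeasurableSpace Ω] [MeasurableSpace 𝓨] (μ : Measure Ω)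
  [IsProbabilityMeasure μ] {X : Ω → ℕ} {Y : Ω → 𝓨} {L : ℕ} {f : 𝓨 → Finset ℕ}

lemma lintegral_sum_condLaw (hX : Measurable X) (hY : Measurable Y) (hf : IsListDecoder L f) :
    ∫⁻ ω, ∑ x ∈ f (Y ω), condLaw μ X Y (Y ω) x ∂μ = μ {ω | X ω ∈ f (Y ω)} := by
  have hsum (y : 𝓨) : ∑ x ∈ f y, condLaw μ X Y y x =
      ∑' x, condLaw μ X Y y x * {z : 𝓨 × ℕ | z.2 ∈ f z.1}.indicator 1 (y, x) := by
    rw [tsum_eq_sum (s := f y) fun x hx => by simp [hx]]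
    exact Finset.sum_congr rfl fun x hx => by simp [hx]
  simp only [hsum]
  rw [lintegral_tsum_condLaw μ hX hY (measurable_one.indicator hf.measurableSet_mem)]
  exact lintegral_indicator_one (hY.prodMk hX hf.measurableSet_mem)

lemma measure_mem_le_rpow_mul_lintegral_alphaNorm (hX : Measurable X) (hY : Measurable Y)
    (hf : IsListDecoder L f) {α : ℝ} (hα : 1 ≤ α) :
    μ {ω | X ω ∈ f (Y ω)} ≤
      (L : ℝ≥0∞) ^ ((α - 1) / α) * ∫⁻ ω, alphaNorm α (condLaw μ X Y (Y ω)) ∂μ := by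
  have hexp : 0 ≤ (α - 1) / α := div_nonneg (sub_nonneg.2 hα) (by positivity)
  rw [← lintegral_sum_condLaw μ hX hY hf, ← lintegral_const_mul' _ _
    (ENNReal.rpow_ne_top_of_nonneg hexp (ENNReal.natCast_ne_top L))]
  refine lintegral_mono fun ω => (sum_le_rpow_mul_alphaNorm hα _ _).trans ?_
  gcongr
  exact (hf.1 (Y ω)).2

theorem arimotoEntropy_le (hX : Measurable X) (hY : Measurable Y) (hf : IsListDecoder L f) {α : ℝ}
    (hα : 1 < α) :
    arimotoEntropy α μ X Y ≤ (Real.log L : EReal) +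
      (ENNReal.ofReal (α / (α - 1)) * surprisal (μ {ω | X ω ∈ f (Y ω)}) : ℝ≥0∞) := by
  obtain ⟨ω₀⟩ := nonempty_of_isProbabilityMeasure μ
  have hL : 0 < L := (hf.1 (Y ω₀)).1.trans (hf.1 (Y ω₀)).2
  have hL0 : (L : ℝ≥0∞) ≠ 0 := by exact_mod_cast hL.ne'
  have hLtop : (L : ℝ≥0∞) ≠ ∞ := ENNReal.natCast_ne_top L
  have hα1 : 0 < α - 1 := sub_pos.2 hα
  set c := α / (α - 1) with hc
  have hc0 : 0 < c := by positivity
  set s := μ {ω | X ω ∈ f (Y ω)}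
  set I := ∫⁻ ω, alphaNorm α (condLaw μ X Y (Y ω)) ∂μ
  have hs : s ^ c ≤ L * I ^ c := by
    have h := ENNReal.rpow_le_rpow
      (measure_mem_le_rpow_mul_lintegral_alphaNorm μ hX hY hf hα.le) hc0.le
    rwa [ENNReal.mul_rpow_of_nonneg _ _ hc0.le, ← ENNReal.rpow_mul,
      show (α - 1) / α * c = 1 by rw [hc]; field_simp, ENNReal.rpow_one] at h
  have hI : (I ^ c)⁻¹ ≤ L * s⁻¹ ^ c :=
    calc (I ^ c)⁻¹ = L * (L * I ^ c)⁻¹ := by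
          rw [ENNReal.mul_inv (.inl hL0) (.inl hLtop), ENNReal.mul_inv_cancel_left hL0 hLtop]
      _ ≤ L * s⁻¹ ^ c := by
          rw [ENNReal.inv_rpow]
          gcongr
  calc arimotoEntropy α μ X Y
      = ENNReal.log (I ^ c)⁻¹ := by
        rw [arimotoEntropy, if_neg hα.ne', ← ENNReal.rpow_neg, ENNReal.log_rpow, hc, ← div_neg,
          neg_sub]
    _ ≤ ENNReal.log (L * s⁻¹ ^ c) := ENNReal.log_le_log hI
    _ = _ := by
        rw [ENNReal.log_mul_add, ENNReal.log_rpow, ← coe_surprisal prob_le_one,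
          EReal.coe_ennreal_mul, EReal.coe_ennreal_ofReal, max_eq_left hc0.le,
          ← ENNReal.ofReal_natCast L, ENNReal.log_ofReal_of_pos (by exact_mod_cast hL)]

theorem hayashiEntropy_le_arimotoEntropy (X : Ω → ℕ) (hY : Measurable Y) {α : ℝ} (hα : 1 ≤ α) :
    hayashiEntropy α μ X Y ≤ arimotoEntropy α μ X Y := by
  rcases hα.eq_or_lt with rfl | hα
  · rw [hayashiEntropy, arimotoEntropy, if_pos rfl, if_pos rfl]
  have : 0 < α - 1 := sub_pos.2 hα
  have hmeas : Measurable fun ω => alphaNorm α (condLaw μ X Y (Y ω)) :=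
    ((Measurable.tsum fun x => (measurable_condLaw μ X Y x).pow_const α).pow_const
      (1 / α)).comp hY
  rw [hayashiEntropy, arimotoEntropy, if_neg hα.ne', if_neg hα.ne', ← ENNReal.log_rpow,
    ← ENNReal.log_rpow, div_eq_mul_one_div α, ENNReal.rpow_mul,
    show 1 / (1 - α) = -(1 / (α - 1)) by rw [← div_neg, neg_sub], ENNReal.rpow_neg,
    ENNReal.rpow_neg]
  gcongr
  exact lintegral_rpow_le_lintegral_rpow μ hα.le hmeas

end Renyi

section Limit

lemma tendsto_max_zero_sub {ι : Type*} {l : Filter ι} {u : ι → EReal} {v : ι → ℝ} {e : ι → ℝ≥0∞}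
    (h : ∀ n, u n ≤ (v n : EReal) + (e n : EReal)) (he : Tendsto e l (𝓝 0)) :
    Tendsto (fun n => max 0 (u n - (v n : EReal))) l (𝓝 0) := by
  have he' : Tendsto (fun n => (e n : EReal)) l (𝓝 0) := by
    simpa [Function.comp_def] using (continuous_coe_ennreal_ereal.tendsto 0).comp he
  refine tendsto_of_tendsto_of_tendsto_of_le_of_le tendsto_const_nhds he'
    (fun n => le_max_left _ _) fun n => max_le (EReal.coe_ennreal_nonneg _) ?_
  rw [EReal.sub_le_iff_le_add (.inl (EReal.coe_ne_bot _)) (.inl (EReal.coe_ne_top _)), add_comm]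
  exact h n

lemma isListDecoder_const_zero {𝓨 : Type*} [MeasurableSpace 𝓨] {L : ℕ} (hL : 1 ≤ L) :
    IsListDecoder L fun _ : 𝓨 => ({0} : Finset ℕ) :=
  ⟨fun _ => ⟨le_rfl, hL⟩, fun _ => MeasurableSet.const _⟩

variable {Ω : ℕ → Type*} [∀ n, MeasurableSpace (Ω n)] {μ : ∀ n, Measure (Ω n)}
  [∀ n, IsProbabilityMeasure (μ n)] {𝓨 : ℕ → Type*} [∀ n, MeasurableSpace (𝓨 n)]
  {X : ∀ n, Ω n → ℕ} {Y : ∀ n, Ω n → 𝓨 n} {L : ℕ → ℕ} {f : ∀ n, 𝓨 n → Finset ℕ}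

lemma exists_isListDecoder_tendsto (hL : ∀ n, 1 ≤ L n)
    (hε : Tendsto (fun n => listError (L n) (μ n) (X n) (Y n)) atTop (𝓝 0)) :
    ∃ f : ∀ n, 𝓨 n → Finset ℕ, (∀ n, IsListDecoder (L n) (f n)) ∧
      Tendsto (fun n => μ n {ω | X n ω ∉ f n (Y n ω)}) atTop (𝓝 0) := by
  have hfin (n : ℕ) : listError (L n) (μ n) (X n) (Y n) ≠ ∞ :=
    ne_top_of_le_ne_top (measure_ne_top _ _) (iInf₂_le _ (isListDecoder_const_zero (hL n)))
  have hnear (n : ℕ) : ∃ f, IsListDecoder (L n) f ∧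
      μ n {ω | X n ω ∉ f (Y n ω)} < listError (L n) (μ n) (X n) (Y n) + (n : ℝ≥0∞)⁻¹ := by
    have h : listError (L n) (μ n) (X n) (Y n) <
        listError (L n) (μ n) (X n) (Y n) + (n : ℝ≥0∞)⁻¹ :=
      ENNReal.lt_add_right (hfin n) (by simp)
    simpa only [listError, iInf_lt_iff, exists_prop] using h
  choose f hf hlt using hnear
  refine ⟨f, hf, tendsto_of_tendsto_of_tendsto_of_le_of_le tendsto_const_nhds ?_
    (fun _ => zero_le) fun n => (hlt n).le⟩
  simpa using hε.add ENNReal.tendsto_inv_nat_nhds_zero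

lemma tendsto_arimotoEntropy_sub_log (hX : ∀ n, Measurable (X n)) (hY : ∀ n, Measurable (Y n))
    (hf : ∀ n, IsListDecoder (L n) (f n))
    (herr : Tendsto (fun n => μ n {ω | X n ω ∉ f n (Y n ω)}) atTop (𝓝 0)) {α : ℝ} (hα : 1 < α) :
    Tendsto (fun n => max 0
      (arimotoEntropy α (μ n) (X n) (Y n) - ((Real.log (L n) : ℝ) : EReal))) atTop (𝓝 0) := by
  refine tendsto_max_zero_sub (fun n => arimotoEntropy_le (μ n) (hX n) (hY n) (hf n) hα) ?_
  have hsucc : Tendsto (fun n => μ n {ω | X n ω ∈ f n (Y n ω)}) atTop (𝓝 1) := by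
    have h : Tendsto (fun n => 1 - μ n {ω | X n ω ∉ f n (Y n ω)}) atTop (𝓝 (1 - 0)) :=
      ENNReal.Tendsto.sub tendsto_const_nhds herr (.inl ENNReal.one_ne_top)
    rw [tsub_zero] at h
    refine h.congr fun n => ?_
    rw [← prob_compl_eq_one_sub ((hf n).measurableSet_error (hX n) (hY n))]
    simp only [Set.compl_ofPred, not_not]
  have hsurp : Tendsto (fun n => surprisal (μ n {ω | X n ω ∈ f n (Y n ω)})) atTop (𝓝 0) := by
    simpa [Function.comp_def, surprisal_one] using (continuous_surprisal.tendsto 1).comp hsucc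
  simpa using ENNReal.Tendsto.const_mul hsurp (.inr ENNReal.ofReal_ne_top)

lemma tendsto_condShannonEntropy_sub_log (hX : ∀ n, Measurable (X n))
    (hY : ∀ n, Measurable (Y n)) (hf : ∀ n, IsListDecoder (L n) (f n))
    (herr : Tendsto (fun n => μ n {ω | X n ω ∉ f n (Y n ω)}) atTop (𝓝 0))
    (hUI : AsympUnifIntegrable μ (fun n ω => surprisal (law (μ n) (X n) (X n ω))) atTop) :
    Tendsto (fun n => max 0
      ((condShannonEntropy (μ n) (X n) (Y n) : EReal) - ((Real.log (L n) : ℝ) : EReal)))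
      atTop (𝓝 0) := by
  have hbin : Tendsto (fun n => ENNReal.ofReal
      (Real.binEntropy ((μ n).real {ω | X n ω ∉ f n (Y n ω)}))) atTop (𝓝 0) := by
    simpa [Function.comp_def, Measure.real] using
      ((ENNReal.continuous_ofReal.comp Real.binEntropy_continuous).tendsto _).comp
        ((ENNReal.tendsto_toReal ENNReal.zero_ne_top).comp herr)
  have htail := hUI _ (fun n => (hf n).measurableSet_error (hX n) (hY n)) herr
  refine tendsto_max_zero_sub (fun n => ?_) (by simpa only [add_zero] using hbin.add htail)
  have h := condShannonEntropy_le (μ n) (hX n) (hY n) (hf n)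
  rwa [← EReal.coe_ennreal_le_coe_ennreal_iff, EReal.coe_ennreal_add (ENNReal.ofReal _),
    EReal.coe_ennreal_ofReal, max_eq_left (Real.log_natCast_nonneg _)] at h

end Limit

end FanoList

open FanoList in
theorem theorem4
    {Ω : ℕ → Type*} [∀ n, MeasurableSpace (Ω n)]
    (μ : ∀ n, Measure (Ω n)) [∀ n, IsProbabilityMeasure (μ n)]
    {𝓨 : ℕ → Type*} [∀ n, MeasurableSpace (𝓨 n)]
    (X : ∀ n, Ω n → ℕ) (hX : ∀ n, Measurable (X n))
    (Y : ∀ n, Ω n → 𝓨 n) (hY : ∀ n, Measurable (Y n))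
    {Ω' : Type*} [MeasurableSpace Ω'] (ν : Measure Ω') [IsProbabilityMeasure ν]
    (Z : Ω' → ℕ) (hZ : Measurable Z) (hHZ : shannonEntropy (law ν Z) < ∞)
    (L : ℕ → ℕ) (hL : ∀ n, 1 ≤ L n)
    (α : ℝ) (hα : 1 ≤ α)
    (hcond :
      1 < α ∨
      (AEP μ X ∧ ∃ C : ℝ≥0, ∀ᶠ n in atTop, shannonEntropy (law (μ n) (X n)) ≤ C) ∨
      (∃ n₀ : ℕ, ∀ n ≥ n₀, Majorizes (law (μ n) (X n)) (law ν Z)) ∨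
      (TendstoInDistribution X atTop Z μ ν ∧
        Tendsto (fun n => shannonEntropy (law (μ n) (X n))) atTop
          (𝓝 (shannonEntropy (law ν Z))))) :
    Tendsto (fun n => listError (L n) (μ n) (X n) (Y n)) atTop (𝓝 0) →
      Tendsto (fun n => max 0
        (arimotoEntropy α (μ n) (X n) (Y n) - ((Real.log (L n) : ℝ) : EReal))) atTop (𝓝 0) ∧
      Tendsto (fun n => max 0
        (hayashiEntropy α (μ n) (X n) (Y n) - ((Real.log (L n) : ℝ) : EReal))) atTop (𝓝 0) := by
  intro hε
  obtain ⟨f, hf, herr⟩ := exists_isListDecoder_tendsto hL hε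
  have hA : Tendsto (fun n => max 0
      (arimotoEntropy α (μ n) (X n) (Y n) - ((Real.log (L n) : ℝ) : EReal))) atTop (𝓝 0) := by
    rcases hα.eq_or_lt with rfl | hα1
    · simp only [arimotoEntropy, if_true]
      refine tendsto_condShannonEntropy_sub_log hX hY hf herr ?_
      rcases hcond with h | ⟨haep, C, hC⟩ | ⟨n₀, hmaj⟩ | ⟨hdist, hent⟩
      · exact absurd h (lt_irrefl 1)
      · exact asympUnifIntegrable_surprisal_of_aep hX haep hC
      · exact asympUnifIntegrable_surprisal_of_majorizes hX (tsum_law ν hZ) hHZ.ne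
          (eventually_atTop.2 ⟨n₀, hmaj⟩)
      · exact asympUnifIntegrable_surprisal_of_tendsto_law hX (fun _ => measure_ne_top _ _)
          hHZ.ne (tendsto_law_of_tendstoInDistribution hX hZ hdist) hent
    · exact tendsto_arimotoEntropy_sub_log hX hY hf herr hα1
  refine ⟨hA, tendsto_of_tendsto_of_tendsto_of_le_of_le tendsto_const_nhds hA
    (fun n => le_max_left _ _) fun n => max_le_max le_rfl ?_⟩
  exact EReal.sub_le_sub (hayashiEntropy_le_arimotoEntropy (μ n) (X n) (hY n) hα) le_rfl
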